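/- A $3$-uniform hypergraph $H=(V,E)$ consists of a finite vertex set $V$ and a set $E$ of $3$-element subsets of $V$. The Fano plane is the (unique) linear $3$-uniform hypergraph with seven vertices and seven hyperedges (linear: any two distinct hyperedges share at most one vertex). $H$ is Fano-free if it has no (not necessarily induced) subhypergraph isomorphic to the Fano plane, and $\mathrm{ex}(n,\mathrm{Fano})$ is the maximum number of hyperedges of a Fano-free $3$-uniform hypergraph on $n$ vertices. For $A\subseteq V$ let $e_H(A)$ be the number of hyperedges of $H$ contained in $A$. **Theorem.** For every fixed real $\delta$ with $0<\delta<(1/36)^8$ there exists $n_0$ such that the following holds for all $n\ge n_0$. If $H=(V,E)$ is a Fano-free $3$-uniform hypergraph on $n$ vertices with at least $\mathrm{ex}(n,\mathrm{Fano})-\delta n^3/8$ hyperedges, then there is a partition $V=A\cup B$ (with $A\cap B=\emptyset$) such that $$e_H(A)+e_H(B)\;\le\;\frac{9}{16}\,\bigl(3^2\cdot 2^4\cdot 139\bigr)^{1/8}\,\delta^{1/64}\,n^3\;<\;1.94\,\delta^{1/64}\,n^3 .$$ -/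

import Mathlib

/-- An `r`-uniform hypergraph with vertex set `V`: a finite set of hyperedges, each of which is
a set of exactly `r` vertices. -/
structure UniformHypergraph (r : ℕ) (V : Type*) where
  edges : Finset (Finset V)
  uniform : ∀ e ∈ edges, e.card = r

namespace UniformHypergraph

/-- `H` contains a (not necessarily induced) copy of `F` as a subhypergraph. -/
def Contains {r : ℕ} {V W : Type*} (H : UniformHypergraph r V) (F : UniformHypergraph r W) :
    Prop :=
  ∃ f : W ↪ V, ∀ e ∈ F.edges, e.map f ∈ H.edges

/-- `H` is `F`-free. -/
def Free {r : ℕ} {V W : Type*} (H : UniformHypergraph r V) (F : UniformHypergraph r W) : Prop :=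
  ¬ H.Contains F

/-- The Turán number `ex(n, F)`: the maximum number of hyperedges of an `F`-free `r`-uniform
hypergraph on `n` vertices. -/
noncomputable def ex {r : ℕ} {W : Type*} (n : ℕ) (F : UniformHypergraph r W) : ℕ :=
  sSup {m : ℕ | ∃ H : UniformHypergraph r (Fin n), H.Free F ∧ H.edges.card = m}

/-- `e_H(A)`: the number of hyperedges of `H` contained in `A`. -/
def edgesIn {r : ℕ} {V : Type*} [DecidableEq V] (H : UniformHypergraph r V) (A : Finset V) : ℕ :=
  (H.edges.filter (fun e => e ⊆ A)).card

set_option maxRecDepth 10000 in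
/-- The Fano plane, with points `0, …, 6` and lines `{i, i + 1, i + 3}` modulo `7`. -/
def fano : UniformHypergraph 3 (Fin 7) where
  edges := {{0, 1, 3}, {1, 2, 4}, {2, 3, 5}, {3, 4, 6}, {4, 5, 0}, {5, 6, 1}, {6, 0, 2}}
  uniform := by decide

set_option maxRecDepth 10000 in
/-- The Fano plane has seven hyperedges, and any two of them share at most one vertex. -/
theorem fano_linear : fano.edges.card = 7 ∧
    ∀ e ∈ fano.edges, ∀ f ∈ fano.edges, e ≠ f → (e ∩ f).card ≤ 1 := by
  decide

end UniformHypergraph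

/-!
Peeling off vertices of small degree, we may assume that the link of every vertex has at least
about `3 / 4 * n ^ 2` ordered pairs. The hypergraph then contains four vertices spanning a complete
`K₄⁽³⁾`. Colour a pair of vertices by those `i` for which it lies in the link of the `i`-th of these
four vertices. As the hypergraph is Fano-free, no `K₄` has its three perfect matchings in three
different colours. Such a colouring carries at most about `3 * n ^ 2` colours in total, and when it
carries nearly that many, the vertices split into two halves `A` and `B` such that each of the four
links avoids the pairs inside one half and contains almost all other pairs.

Let `p` be one of the four vertices, with no link pair inside `B`. A vertex `x` has a link that
either nearly contains the link of `p` or contains most of the pairs inside `B`, with few exceptions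
`x`: otherwise `p` and `x` would lie in a common `K₄⁽³⁾`, which forces the first alternative. Both
classes are independent, since the links of the vertices of a hyperedge would share so many pairs
that Turán's theorem provides a common `K₄`, hence a Fano plane.
-/

open Finset

section FinsetLemmas

variable {V : Type*}

theorem exists_clique_of_lt_card {U : Finset V} {R : V → V → Prop} [DecidableRel R]
    (symm : ∀ x y, R x y → R y x) (irrefl : ∀ x, ¬ R x x) {r : ℕ}
    (h : (r - 1) * #U ^ 2 < r * #{p ∈ U ×ˢ U | R p.1 p.2}) :
    ∃ f : Fin (r + 1) → V, (∀ i, f i ∈ U) ∧ ∀ i j, i ≠ j → R (f i) (f j) := by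
  let G : SimpleGraph U :=
    { Adj := fun x y => R x y, symm := ⟨fun x y => symm x y⟩, loopless := ⟨fun x => irrefl x⟩ }
  let _ : DecidableRel G.Adj := fun x y => inferInstanceAs (Decidable (R x y))
  have hG : ¬ G.CliqueFree (r + 1) := fun hfree => by
    have hpairs : #{p ∈ U ×ˢ U | R p.1 p.2} = 2 * #G.edgeFinset := by
      rw [← G.sum_degrees_eq_twice_card_edges, card_filter, sum_product, ← sum_coe_sort]
      refine sum_congr rfl fun x _ => ?_
      rw [← G.card_neighborFinset_eq_degree, G.neighborFinset_eq_filter, card_filter,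
        ← sum_coe_sort]
    have hturan : #G.edgeFinset ≤ #(SimpleGraph.turanGraph #U r).edgeFinset := by
      simpa [SimpleGraph.card_edgeFinset_turanGraph] using hfree.card_edgeFinset_le
    have := SimpleGraph.mul_card_edgeFinset_turanGraph_le (n := #U) (r := r)
    have := Nat.mul_le_mul_left (2 * r) hturan
    rw [hpairs] at h
    linarith
  rw [SimpleGraph.not_cliqueFree_iff_top_isContained] at hG
  obtain ⟨f⟩ := hG
  exact ⟨fun i => f i, fun i => (f i).2, fun i j hij => f.toHom.map_adj hij⟩

variable [DecidableEq V]

theorem le_empty_of_forall_exists_erase {β : Type*} [Preorder β] {F : Finset V → β}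
    (hF : ∀ W : Finset V, W.Nonempty → ∃ x ∈ W, F W ≤ F (W.erase x)) (W : Finset V) :
    F W ≤ F ∅ := by
  induction W using Finset.strongInduction with
  | H W ih =>
    rcases W.eq_empty_or_nonempty with rfl | hW
    · exact le_rfl
    · obtain ⟨x, hx, hle⟩ := hF W hW
      exact hle.trans (ih _ (erase_ssubset hx))

-- A maximiser of `F W - (c - η) * #W ^ (k + 1)` is large and loses much at each removed point.
theorem exists_subset_forall_le_sub_erase {F : Finset V → ℝ} {U : Finset V} {k : ℕ}
    {c D η : ℝ} (hη : 0 < η) (hF : ∀ W, F W ≤ c * #W ^ (k + 1) + D * #W ^ k)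
    (hD : D ≤ η ^ 2 * #U) (hU : (c - η ^ 2) * #U ^ (k + 1) ≤ F U) :
    ∃ W ⊆ U, (1 - 2 * η) * #U ≤ #W ∧
      ∀ x ∈ W, (c - η) * ((#W : ℝ) ^ (k + 1) - (#W - 1) ^ (k + 1)) ≤ F W - F (W.erase x) := by
  obtain ⟨W, hW, hmax⟩ := exists_max_image U.powerset
    (fun W => F W - (c - η) * (#W : ℝ) ^ (k + 1)) ⟨U, by simp⟩
  rw [mem_powerset] at hW
  have hWU : (#W : ℝ) ≤ #U := mod_cast card_le_card hW
  refine ⟨W, hW, ?_, fun x hx => ?_⟩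
  · rcases (Nat.cast_nonneg (α := ℝ) #U).eq_or_lt with hU₀ | hU₀
    · rw [← hU₀, mul_zero]
      positivity
    have hlow : (η - η ^ 2) * (#U : ℝ) ^ (k + 1) ≤ F W - (c - η) * #W ^ (k + 1) := by
      have := hmax U (by simp)
      linarith
    have hup : F W - (c - η) * #W ^ (k + 1) ≤ (η * #W + η ^ 2 * #U) * #U ^ k := by
      calc F W - (c - η) * #W ^ (k + 1) ≤ (η * #W + D) * #W ^ k := by
            linear_combination hF W
        _ ≤ (η * #W + η ^ 2 * #U) * #U ^ k := by gcongr
    have hpow : (0 : ℝ) < η * #U ^ k := by positivity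
    refine le_of_mul_le_mul_left ?_ hpow
    linear_combination hlow + hup
  · have := hmax (W.erase x) (mem_powerset.2 ((erase_subset x W).trans hW))
    rw [cast_card_erase_of_mem hx] at this
    linarith

end FinsetLemmas

section Colouring

variable {V : Type*} {C : V → V → Finset (Fin 4)} {W : Finset V} {γ : ℝ} {a b c d x y z t u : V}

/-- A symmetric assignment of sets of colours to the pairs of vertices, empty on the diagonal, for
which no four vertices have their three perfect matchings in three different colours. -/
structure RainbowFree (C : V → V → Finset (Fin 4)) : Prop where
  symm : ∀ x y, C x y = C y x
  irrefl : ∀ x, C x x = ∅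
  free : ∀ a b c d, ∀ i ∈ C a b ∩ C c d, ∀ j ∈ C a c ∩ C b d, ∀ k ∈ C a d ∩ C b c,
    i ≠ j → i ≠ k → j ≠ k → False

/-- The number of coloured pairs `xy` with `y ∈ W`, each counted once for each of its colours. -/
def colourDegree (C : V → V → Finset (Fin 4)) (W : Finset V) (x : V) : ℕ := ∑ y ∈ W, #(C x y)

/-- The number of coloured ordered pairs in `W`, each counted once for each of its colours. -/
def colourVolume (C : V → V → Finset (Fin 4)) (W : Finset V) : ℕ := ∑ x ∈ W, colourDegree C W x

/-- A rainbow-free colouring whose minimum colour degree in the nonempty set `W` is nearly the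
largest possible one, `3 * #W`. -/
structure DenseRainbowFree (C : V → V → Finset (Fin 4)) (W : Finset V) (γ : ℝ) : Prop
    extends RainbowFree C where
  nonempty : W.Nonempty
  le_colourDegree : ∀ x ∈ W, (3 - γ) * #W ≤ colourDegree C W x

theorem card_union_le_of_no_transversal {α : Type*} [DecidableEq α] {X Y Z : Finset α}
    (h : ∀ i ∈ X, ∀ j ∈ Y, ∀ k ∈ Z, i ≠ j → i ≠ k → j ≠ k → False) :
    #X = 0 ∨ #Y = 0 ∨ #Z = 0 ∨ #(X ∪ Y) ≤ 1 ∨ #(X ∪ Z) ≤ 1 ∨ #(Y ∪ Z) ≤ 1 ∨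
      #(X ∪ (Y ∪ Z)) ≤ 2 := by
  by_contra! hc
  have hsub : ∀ s : Finset (Fin 3), s = ∅ ∨ s = {0} ∨ s = {1} ∨ s = {2} ∨ s = {0, 1} ∨
      s = {0, 2} ∨ s = {1, 2} ∨ s = {0, 1, 2} := by decide
  have hall : ∀ s : Finset (Fin 3), #s ≤ #(s.biUnion ![X, Y, Z]) := fun s => by
    rcases hsub s with rfl | rfl | rfl | rfl | rfl | rfl | rfl | rfl <;>
      simp [-card_pos, -one_le_card] <;> omega
  obtain ⟨f, hf, hmem⟩ := (all_card_le_biUnion_card_iff_exists_injective _).1 hall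
  exact h (f 0) (hmem 0) (f 1) (hmem 1) (f 2) (hmem 2) (hf.ne (by decide)) (hf.ne (by decide))
    (hf.ne (by decide))

theorem card_le_of_no_transversal {α : Type*} {X Y Z : Finset α}
    (h : ∀ i ∈ X, ∀ j ∈ Y, ∀ k ∈ Z, i ≠ j → i ≠ k → j ≠ k → False) :
    #X = 0 ∨ #Y = 0 ∨ #Z = 0 ∨ #X ≤ 1 ∧ #Y ≤ 1 ∨ #X ≤ 1 ∧ #Z ≤ 1 ∨ #Y ≤ 1 ∧ #Z ≤ 1 ∨
      #X ≤ 2 ∧ #Y ≤ 2 ∧ #Z ≤ 2 := by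
  classical
  have hl (S T : Finset α) : #S ≤ #(S ∪ T) := card_le_card subset_union_left
  have hr (S T : Finset α) : #T ≤ #(S ∪ T) := card_le_card subset_union_right
  have := card_union_le_of_no_transversal h
  have := hl X Y
  have := hr X Y
  have := hl X Z
  have := hr X Z
  have := hl Y Z
  have := hr Y Z
  have := hl X (Y ∪ Z)
  have := hr X (Y ∪ Z)
  omega

theorem eq_of_no_transversal {α : Type*} {X Y Z : Finset α}
    (h : ∀ i ∈ X, ∀ j ∈ Y, ∀ k ∈ Z, i ≠ j → i ≠ k → j ≠ k → False) (hX : 2 ≤ #X) (hY : 2 ≤ #Y)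
    (hZ : 2 ≤ #Z) : X = Y ∧ X = Z := by
  classical
  have hXYZ : #(X ∪ (Y ∪ Z)) ≤ 2 := by
    have := card_union_le_of_no_transversal h
    have := card_le_card (subset_union_left (s₁ := X) (s₂ := Y))
    have := card_le_card (subset_union_left (s₁ := X) (s₂ := Z))
    have := card_le_card (subset_union_left (s₁ := Y) (s₂ := Z))
    omega
  have hXu := eq_of_subset_of_card_le (subset_union_left : X ⊆ X ∪ (Y ∪ Z)) (by omega)
  have hYu := eq_of_subset_of_card_le (t := X ∪ (Y ∪ Z)) (s := Y) (by grind) (by omega)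
  have hZu := eq_of_subset_of_card_le (t := X ∪ (Y ∪ Z)) (s := Z) (by grind) (by omega)
  exact ⟨hXu.trans hYu.symm, hXu.trans hZu.symm⟩

theorem card_colours_le (X : Finset (Fin 4)) : #X ≤ 4 := card_le_univ X

theorem eq_univ_of_card_colours {X : Finset (Fin 4)} (hX : #X = 4) : X = univ :=
  (card_eq_iff_eq_univ X).1 hX

theorem card_colours_add_le (X Y : Finset (Fin 4)) : #X + #Y ≤ #(X ∩ Y) + 4 := by
  rw [← card_union_add_card_inter, add_comm]
  exact Nat.add_le_add_left (card_colours_le _) _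

namespace RainbowFree

theorem star_le (h : RainbowFree C) (hxz : #(C x z) = 4) (hyz : #(C y z) = 4)
    (hxy : 3 ≤ #(C x y)) (t : V) : 2 * #(C x t) + 2 * #(C y t) + 3 * #(C z t) ≤ 20 := by
  have hmatch := card_le_of_no_transversal (h.free x y z t)
  simp only [eq_univ_of_card_colours hxz, eq_univ_of_card_colours hyz, univ_inter, inter_univ]
    at hmatch
  have := card_colours_add_le (C x y) (C z t)
  have := card_colours_le (C x t)
  have := card_colours_le (C y t)
  have := card_colours_le (C z t)
  omega

theorem card_le_two_of_three_three (h : RainbowFree C) (hxy : #(C x y) = 4) (hxt : #(C x t) = 3)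
    (hyt : #(C y t) = 3) (hz : #(C x z) + #(C y z) = 6) : #(C t z) ≤ 2 := by
  have hmatch := card_le_of_no_transversal (h.free x y t z)
  simp only [eq_univ_of_card_colours hxy, univ_inter] at hmatch
  have := card_colours_add_le (C x t) (C y z)
  have := card_colours_add_le (C x z) (C y t)
  have := card_colours_le (C x z)
  have := card_colours_le (C y z)
  omega

theorem disjoint_of_full (h : RainbowFree C) (hac : #(C a c) = 4) (hbd : #(C b d) = 4)
    (had : #(C a d) = 4) (hbc : #(C b c) = 4) : Disjoint (C a b) (C c d) := by
  have hmatch := card_le_of_no_transversal (h.free a b c d)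
  simp only [eq_univ_of_card_colours hac, eq_univ_of_card_colours had, univ_inter, hbd, hbc]
    at hmatch
  rw [disjoint_iff_inter_eq_empty, ← card_eq_zero]
  omega

theorem missing_colours (h : RainbowFree C) {p p' q q' r r' : Fin 4} (hab : C a b = {p}ᶜ)
    (hcd : C c d = {p'}ᶜ) (hac : C a c = {q}ᶜ) (hbd : C b d = {q'}ᶜ) (had : C a d = {r}ᶜ)
    (hbc : C b c = {r'}ᶜ) : p ≠ p' ∧ (q = p ∧ q' = p' ∨ q = p' ∧ q' = p) ∧
      (r = p ∧ r' = p' ∨ r = p' ∧ r' = p) := by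
  have hfree := h.free a b c d
  have hcompl (i j : Fin 4) : ({i}ᶜ : Finset (Fin 4)) ∩ {j}ᶜ = {i, j}ᶜ := by
    rw [← compl_union, ← insert_eq]
  simp only [hab, hcd, hac, hbd, had, hbc, hcompl] at hfree
  have hcard (i j : Fin 4) : 2 ≤ #({i, j}ᶜ : Finset (Fin 4)) := by
    have := card_le_two (a := i) (b := j)
    simp only [card_compl, Fintype.card_fin]
    omega
  have hmatch := card_le_of_no_transversal hfree
  have heq := eq_of_no_transversal hfree (hcard _ _) (hcard _ _) (hcard _ _)
  refine ⟨?_, ?_, ?_⟩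
  · rintro rfl
    rw [← heq.1, ← heq.2, pair_eq_singleton, card_compl, Fintype.card_fin, card_singleton] at hmatch
    omega
  · have := heq.1
    rw [compl_inj_iff, ← coe_inj, coe_pair, coe_pair, Set.pair_eq_pair_iff] at this
    tauto
  · have := heq.2
    rw [compl_inj_iff, ← coe_inj, coe_pair, coe_pair, Set.pair_eq_pair_iff] at this
    tauto

/-- In a counterexample every four vertices span exactly one triangle all of whose sides miss the
same colour; as each triangle lies in two of the five quadruples, this is impossible. -/
theorem not_forall_card_eq_three (h : RainbowFree C) (f : Fin 5 → V) :
    ¬ ∀ i j, i ≠ j → #(C (f i) (f j)) = 3 := by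
  intro hf
  have hmissing (i j : Fin 5) : ∃ m, i ≠ j → C (f i) (f j) = {m}ᶜ := by
    by_cases hij : i = j
    · exact ⟨0, fun hne => (hne hij).elim⟩
    · obtain ⟨m, hm⟩ := card_eq_one.1
        (show #((C (f i) (f j))ᶜ) = 1 by rw [card_compl, hf i j hij, Fintype.card_fin])
      exact ⟨m, fun _ => by rw [← hm, compl_compl]⟩
  choose m hm using hmissing
  have hquad (a b c d : Fin 5) (hne : a ≠ b ∧ a ≠ c ∧ a ≠ d ∧ b ≠ c ∧ b ≠ d ∧ c ≠ d) :=
    h.missing_colours (hm a b hne.1) (hm c d hne.2.2.2.2.2) (hm a c hne.2.1)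
      (hm b d hne.2.2.2.2.1) (hm a d hne.2.2.1) (hm b c hne.2.2.2.1)
  have h0123 := hquad 0 1 2 3 (by decide)
  have h0124 := hquad 0 1 2 4 (by decide)
  have h0134 := hquad 0 1 3 4 (by decide)
  have h0234 := hquad 0 2 3 4 (by decide)
  have h1234 := hquad 1 2 3 4 (by decide)
  clear hquad hm
  grind

theorem colourVolume_erase [DecidableEq V] (h : RainbowFree C) (hx : x ∈ W) :
    colourVolume C W = colourVolume C (W.erase x) + 2 * colourDegree C W x := by
  have hdeg (y : V) : colourDegree C W y = #(C x y) + colourDegree C (W.erase x) y := by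
    rw [colourDegree, ← add_sum_erase W _ hx, h.symm y x, colourDegree]
  have hxx : #(C x x) = 0 := by rw [h.irrefl, card_empty]
  rw [colourVolume, ← add_sum_erase W _ hx, sum_congr rfl fun y _ => hdeg y, sum_add_distrib,
    ← colourDegree, ← colourVolume]
  have := hdeg x
  omega

end RainbowFree

namespace DenseRainbowFree

theorem card_pos (h : DenseRainbowFree C W γ) : (0 : ℝ) < #W := mod_cast h.nonempty.card_pos

theorem card_le_two_of_full (h : DenseRainbowFree C W γ) (hγ : γ < 1 / 7) (hx : x ∈ W)
    (hy : y ∈ W) (hz : z ∈ W) (hxz : #(C x z) = 4) (hyz : #(C y z) = 4) : #(C x y) ≤ 2 := by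
  by_contra! hxy
  have hsum : 2 * colourDegree C W x + 2 * colourDegree C W y + 3 * colourDegree C W z
      ≤ #W * 20 := by
    simp only [colourDegree, mul_sum, ← sum_add_distrib]
    exact sum_le_card_nsmul _ _ _ fun t _ => h.star_le hxz hyz hxy t
  have hsum' : (2 * colourDegree C W x + 2 * colourDegree C W y + 3 * colourDegree C W z : ℝ)
      ≤ #W * 20 := mod_cast hsum
  nlinarith [h.le_colourDegree x hx, h.le_colourDegree y hy, h.le_colourDegree z hz, h.card_pos]

theorem card_add_card_le_six (h : DenseRainbowFree C W γ) (hγ : γ < 1 / 7) (hx : x ∈ W)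
    (hy : y ∈ W) (hz : z ∈ W) (hxy : #(C x y) = 4) : #(C x z) + #(C y z) ≤ 6 := by
  have hxz : #(C x z) = 4 → #(C y z) ≤ 2 := fun hxz =>
    h.card_le_two_of_full hγ hy hz hx (by rwa [h.symm]) (by rwa [h.symm])
  have hyz : #(C y z) = 4 → #(C x z) ≤ 2 := fun hyz =>
    h.card_le_two_of_full hγ hx hz hy hxy (by rwa [h.symm])
  have := card_colours_le (C x z)
  have := card_colours_le (C y z)
  omega

theorem exists_full_pair (h : DenseRainbowFree C W γ) (hγ : γ < 1 / 4) :
    ∃ x ∈ W, ∃ y ∈ W, #(C x y) = 4 := by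
  by_contra! hfull
  have hvolume : colourVolume C W ≤ 2 * #W ^ 2 + #{p ∈ W ×ˢ W | #(C p.1 p.2) = 3} := by
    have hpair (p : V × V) (hp : p ∈ W ×ˢ W) :
        #(C p.1 p.2) ≤ 2 + if #(C p.1 p.2) = 3 then 1 else 0 := by
      have := hfull p.1 (mem_product.1 hp).1 p.2 (mem_product.1 hp).2
      have := card_colours_le (C p.1 p.2)
      split_ifs <;> omega
    calc colourVolume C W = ∑ p ∈ W ×ˢ W, #(C p.1 p.2) :=
          (sum_product W W fun p => #(C p.1 p.2)).symm
      _ ≤ ∑ p ∈ W ×ˢ W, (2 + if #(C p.1 p.2) = 3 then 1 else 0) := sum_le_sum hpair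
      _ = _ := by
        rw [sum_add_distrib, sum_const, card_product, ← card_filter, smul_eq_mul]
        ring
  have hdense : (3 - γ) * #W ^ 2 ≤ colourVolume C W := by
    calc (3 - γ) * #W ^ 2 = #W • ((3 - γ) * #W) := by rw [nsmul_eq_mul]; ring
      _ ≤ ∑ x ∈ W, (colourDegree C W x : ℝ) := card_nsmul_le_sum _ _ _ h.le_colourDegree
      _ = colourVolume C W := by rw [colourVolume, Nat.cast_sum]
  have hmany : 3 * #W ^ 2 < 4 * #{p ∈ W ×ˢ W | #(C p.1 p.2) = 3} := by
    have hvolume' : (colourVolume C W : ℝ) ≤ 2 * #W ^ 2 + #{p ∈ W ×ˢ W | #(C p.1 p.2) = 3} :=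
      mod_cast hvolume
    have hpos : 0 < (1 - 4 * γ) * #W ^ 2 := mul_pos (by linarith) (pow_pos h.card_pos 2)
    have : (3 * #W ^ 2 : ℝ) < 4 * #{p ∈ W ×ˢ W | #(C p.1 p.2) = 3} := by linarith
    exact_mod_cast this
  obtain ⟨f, -, hf⟩ := exists_clique_of_lt_card (R := fun x y => #(C x y) = 3) (r := 4)
    (fun x y hxy => by rwa [h.symm]) (fun x => by simp [h.irrefl]) hmany
  exact h.not_forall_card_eq_three f hf

end DenseRainbowFree

namespace RainbowFree

theorem exists_colourDegree_le (h : RainbowFree C) (hW : W.Nonempty) :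
    ∃ x ∈ W, colourDegree C W x ≤ 3 * #W := by
  by_contra! hd
  have hdense : DenseRainbowFree C W 0 :=
    { h with
      nonempty := hW
      le_colourDegree := fun x hx => by
        rw [sub_zero]
        exact_mod_cast (hd x hx).le }
  obtain ⟨x, hx, y, hy, hxy⟩ := hdense.exists_full_pair (by norm_num)
  have hsum : colourDegree C W x + colourDegree C W y ≤ #W * 6 := by
    rw [colourDegree, colourDegree, ← sum_add_distrib]
    exact sum_le_card_nsmul _ _ _ fun z hz =>
      hdense.card_add_card_le_six (by norm_num) hx hy hz hxy
  have := hd x hx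
  have := hd y hy
  omega

theorem colourVolume_le (h : RainbowFree C) (W : Finset V) :
    (colourVolume C W : ℝ) ≤ 3 * #W ^ 2 + 3 * #W := by
  classical
  have hpeel := le_empty_of_forall_exists_erase
    (F := fun W => (colourVolume C W : ℝ) - (3 * #W ^ 2 + 3 * #W)) (fun W hW => by
      obtain ⟨x, hx, hdeg⟩ := h.exists_colourDegree_le hW
      have hdeg' : (colourDegree C W x : ℝ) ≤ 3 * #W := mod_cast hdeg
      refine ⟨x, hx, ?_⟩
      rw [h.colourVolume_erase hx, cast_card_erase_of_mem hx]
      push_cast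
      linarith) W
  simpa [colourVolume] using hpeel

theorem exists_dense_subset (h : RainbowFree C) {U : Finset V} {η : ℝ} (hη : 0 < η)
    (hη' : η ≤ 1 / 4) (hm : 6 / η ^ 2 ≤ #U) (hU : (3 - η ^ 2) * #U ^ 2 ≤ colourVolume C U) :
    ∃ W ⊆ U, (1 - 2 * η) * #U ≤ #W ∧ DenseRainbowFree C W (2 * η) := by
  classical
  rw [div_le_iff₀' (by positivity)] at hm
  obtain ⟨W, hWU, hcard, hmin⟩ := exists_subset_forall_le_sub_erase
    (F := fun W => (colourVolume C W : ℝ)) (k := 1) (D := 3) hη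
    (fun W => by simpa using h.colourVolume_le W) (by linarith) hU
  have hW : 3 / 2 ≤ η * #W := by nlinarith
  refine ⟨W, hWU, hcard, { h with nonempty := ?_, le_colourDegree := fun x hx => ?_ }⟩
  · rw [← Finset.card_pos]
    by_contra! h₀
    norm_num [Nat.le_zero.1 h₀] at hW
  · have := hmin x hx
    rw [h.colourVolume_erase hx] at this
    push_cast at this
    nlinarith

end RainbowFree

/-- The vertices of `W` with two colours to `x` and four colours to `y`. If `xy` is a pair with all
four colours, then `side C W x y` and `side C W y x` are the two halves of a dense colouring. -/
def side (C : V → V → Finset (Fin 4)) (W : Finset V) (x y : V) : Finset V :=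
  {z ∈ W | #(C x z) = 2 ∧ #(C y z) = 4}

theorem mem_side : z ∈ side C W x y ↔ z ∈ W ∧ #(C x z) = 2 ∧ #(C y z) = 4 := mem_filter

theorem side_subset : side C W x y ⊆ W := filter_subset _ _

theorem disjoint_side : Disjoint (side C W x y) (side C W y x) := by
  simp only [disjoint_left, mem_side]
  omega

namespace DenseRainbowFree

theorem card_not_six_le (h : DenseRainbowFree C W γ) (hγ : γ < 1 / 7) (hx : x ∈ W)
    (hy : y ∈ W) (hxy : #(C x y) = 4) :
    (#{z ∈ W | #(C x z) + #(C y z) ≠ 6} : ℝ) ≤ 2 * γ * #W := by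
  have hsum : colourDegree C W x + colourDegree C W y + #{z ∈ W | #(C x z) + #(C y z) ≠ 6}
      ≤ #W * 6 := by
    rw [colourDegree, colourDegree, card_filter, ← sum_add_distrib, ← sum_add_distrib]
    refine sum_le_card_nsmul _ _ _ fun z hz => ?_
    have := h.card_add_card_le_six hγ hx hy hz hxy
    split_ifs <;> omega
  have hsum' : (colourDegree C W x + colourDegree C W y +
      #{z ∈ W | #(C x z) + #(C y z) ≠ 6} : ℝ) ≤ #W * 6 := mod_cast hsum
  linarith [h.le_colourDegree x hx, h.le_colourDegree y hy]

theorem not_three_three (h : DenseRainbowFree C W γ) (hγ : γ < 1 / 7) (hx : x ∈ W)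
    (hy : y ∈ W) (hxy : #(C x y) = 4) (ht : t ∈ W) : ¬ (#(C x t) = 3 ∧ #(C y t) = 3) := by
  rintro ⟨hxt, hyt⟩
  have hsum : colourDegree C W t ≤ #W * 2 + 2 * #{z ∈ W | #(C x z) + #(C y z) ≠ 6} := by
    rw [colourDegree, card_filter, mul_sum, ← smul_eq_mul, ← sum_const, ← sum_add_distrib]
    refine sum_le_sum fun z _ => ?_
    have := card_colours_le (C t z)
    have := h.card_le_two_of_three_three (z := z) hxy hxt hyt
    split_ifs <;> omega
  have hsum' : (colourDegree C W t : ℝ) ≤ #W * 2 + 2 * #{z ∈ W | #(C x z) + #(C y z) ≠ 6} :=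
    mod_cast hsum
  nlinarith [h.le_colourDegree t ht, h.card_not_six_le hγ hx hy hxy, h.card_pos]

theorem card_le_card_side_add_card_side (h : DenseRainbowFree C W γ) (hγ : γ < 1 / 7) (hx : x ∈ W)
    (hy : y ∈ W) (hxy : #(C x y) = 4) :
    (1 - 2 * γ) * #W ≤ #(side C W x y) + #(side C W y x) := by
  classical
  have hcover : W ⊆ side C W x y ∪ side C W y x ∪ {z ∈ W | #(C x z) + #(C y z) ≠ 6} := by
    intro z hz
    simp only [mem_union, mem_side, mem_filter, hz, true_and]
    have := h.card_add_card_le_six hγ hx hy hz hxy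
    have := h.not_three_three hγ hx hy hxy hz
    have := card_colours_le (C x z)
    have := card_colours_le (C y z)
    omega
  have hcard : #W ≤ #(side C W x y) + #(side C W y x) + #{z ∈ W | #(C x z) + #(C y z) ≠ 6} :=
    (card_le_card hcover).trans <| (card_union_le _ _).trans <|
      Nat.add_le_add_right (card_union_le _ _) _
  have hcard' : (#W : ℝ) ≤ #(side C W x y) + #(side C W y x) +
      #{z ∈ W | #(C x z) + #(C y z) ≠ 6} := mod_cast hcard
  linarith [h.card_not_six_le hγ hx hy hxy]

theorem card_add_card_not_full_le [DecidableEq V] (h : DenseRainbowFree C W γ) {A : Finset V}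
    (hA : A ⊆ W) (hz : z ∈ W) (hzA : ∀ t ∈ A, #(C z t) ≤ 2) :
    (2 * #A + #{t ∈ W \ A | #(C z t) ≠ 4} : ℝ) ≤ (1 + γ) * #W := by
  have hin : ∑ t ∈ A, #(C z t) ≤ #A * 2 := sum_le_card_nsmul _ _ _ hzA
  have hout : ∑ t ∈ W \ A, #(C z t) + #{t ∈ W \ A | #(C z t) ≠ 4} ≤ #(W \ A) * 4 := by
    rw [card_filter, ← sum_add_distrib]
    refine sum_le_card_nsmul _ _ _ fun t _ => ?_
    have := card_colours_le (C z t)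
    split_ifs <;> omega
  have hdeg : ∑ t ∈ W \ A, #(C z t) + ∑ t ∈ A, #(C z t) = colourDegree C W z := sum_sdiff hA
  have hcard : #(W \ A) + #A = #W := card_sdiff_add_card_eq_card hA
  have hsum : colourDegree C W z + 2 * #A + #{t ∈ W \ A | #(C z t) ≠ 4} ≤ 4 * #W := by omega
  have hsum' : (colourDegree C W z + 2 * #A + #{t ∈ W \ A | #(C z t) ≠ 4} : ℝ) ≤ 4 * #W :=
    mod_cast hsum
  linarith [h.le_colourDegree z hz]

theorem card_le_two_of_mem_side (h : DenseRainbowFree C W γ) (hγ : γ < 1 / 7) (hy : y ∈ W)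
    (hz : z ∈ side C W x y) (ht : t ∈ side C W x y) : #(C z t) ≤ 2 := by
  rw [mem_side] at hz ht
  exact h.card_le_two_of_full hγ hz.1 ht.1 hy (by rw [h.symm, hz.2.2]) (by rw [h.symm, ht.2.2])

theorem le_card_side (h : DenseRainbowFree C W γ) (hγ : γ < 1 / 7) (hx : x ∈ W)
    (hy : y ∈ W) (hxy : #(C x y) = 4) : (1 / 2 - 5 / 2 * γ) * #W ≤ #(side C W x y) := by
  classical
  have hsum := h.card_le_card_side_add_card_side hγ hx hy hxy
  rcases (side C W y x).eq_empty_or_nonempty with hempty | ⟨z, hz⟩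
  · rw [hempty, card_empty, Nat.cast_zero, add_zero] at hsum
    have : 0 ≤ 2 * γ * #W := (Nat.cast_nonneg _).trans (h.card_not_six_le hγ hx hy hxy)
    linarith [h.card_pos]
  · have := h.card_add_card_not_full_le side_subset (mem_side.1 hz).1
      fun t ht => h.card_le_two_of_mem_side hγ hx hz ht
    have : (0 : ℝ) ≤ #{t ∈ W \ side C W y x | #(C z t) ≠ 4} := Nat.cast_nonneg _
    linarith

theorem le_card_full_side (h : DenseRainbowFree C W γ) (hγ : γ < 1 / 7) (hx : x ∈ W) (hy : y ∈ W)
    (hxy : #(C x y) = 4) (hz : z ∈ side C W x y) :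
    (1 / 2 - 9 * γ) * #W ≤ #{t ∈ side C W y x | #(C z t) = 4} := by
  classical
  have hdeg := h.card_add_card_not_full_le side_subset (mem_side.1 hz).1
    fun t ht => h.card_le_two_of_mem_side hγ hy hz ht
  have hsub : {t ∈ side C W y x | #(C z t) ≠ 4} ⊆ {t ∈ W \ side C W x y | #(C z t) ≠ 4} :=
    filter_subset_filter _ (subset_sdiff.2 ⟨side_subset, disjoint_side⟩)
  have hnot : (#{t ∈ side C W y x | #(C z t) ≠ 4} : ℝ) ≤
      #{t ∈ W \ side C W x y | #(C z t) ≠ 4} := mod_cast card_le_card hsub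
  have hsplit : (#{t ∈ side C W y x | #(C z t) = 4} + #{t ∈ side C W y x | #(C z t) ≠ 4} : ℝ) =
      #(side C W y x) := mod_cast card_filter_add_card_filter_not _
  have hγ₀ : 0 ≤ 2 * γ * #W := (Nat.cast_nonneg _).trans (h.card_not_six_le hγ hx hy hxy)
  linarith [h.le_card_side hγ hx hy hxy, h.le_card_side hγ hy hx (by rwa [h.symm])]

theorem exists_parts (h : DenseRainbowFree C W γ) (hγ : γ < 1 / 18) :
    ∃ A ⊆ W, ∃ B ⊆ W, Disjoint A B ∧ (1 / 2 - 9 * γ) * #W ≤ #A ∧ (1 / 2 - 9 * γ) * #W ≤ #B ∧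
      ∀ i, (∀ p ∈ A, ∀ q ∈ A, i ∉ C p q) ∨ ∀ p ∈ B, ∀ q ∈ B, i ∉ C p q := by
  have hγ' : γ < 1 / 7 := by linarith
  have hpos : 0 < (1 / 2 - 9 * γ) * #W := mul_pos (by linarith) h.card_pos
  have hne {S : Finset V} (hS : (1 / 2 - 9 * γ) * #W ≤ #S) : S.Nonempty :=
    Finset.card_pos.1 (Nat.cast_pos.1 (hpos.trans_le hS))
  obtain ⟨x, hx, y, hy, hxy⟩ := h.exists_full_pair (by linarith)
  have hyx : #(C y x) = 4 := by rwa [h.symm]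
  have hpos' : 0 < (1 / 2 - 5 / 2 * γ) * #W := mul_pos (by linarith) h.card_pos
  obtain ⟨u, hu⟩ : (side C W y x).Nonempty := Finset.card_pos.1
    (Nat.cast_pos.1 (hpos'.trans_le (h.le_card_side hγ' hy hx hyx)))
  have hA := h.le_card_full_side hγ' hy hx hyx hu
  obtain ⟨z, hzA⟩ := hne hA
  obtain ⟨hz, huz⟩ := mem_filter.1 hzA
  have hB := h.le_card_full_side hγ' hx hy hxy hz
  rw [mem_side] at hu hz
  have hxz_yu : Disjoint (C x z) (C y u) := h.disjoint_of_full hxy (by rwa [h.symm]) hu.2.2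
    (by rw [h.symm, hz.2.2])
  refine ⟨_, (filter_subset _ _).trans side_subset, _, (filter_subset _ _).trans side_subset,
    disjoint_side.mono (filter_subset _ _) (filter_subset _ _), hA, hB, fun i => ?_⟩
  have hcover : i ∈ C y u ∪ C x z := by
    rw [eq_univ_of_card_colours (X := C y u ∪ C x z)]
    · exact mem_univ i
    · rw [card_union_of_disjoint hxz_yu.symm, hu.2.1, hz.2.1]
  refine (mem_union.1 hcover).imp (fun hi p hp q hq hpq => ?_) fun hi p hp q hq hpq => ?_ <;>
    simp only [mem_filter, mem_side] at hp hq
  · exact disjoint_left.1 (h.disjoint_of_full (a := p) (b := q) (c := y) (d := u)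
      (by rw [h.symm, hp.1.2.2]) (by rw [h.symm, hq.2]) (by rw [h.symm, hp.2])
      (by rw [h.symm, hq.1.2.2])) hpq hi
  · exact disjoint_left.1 (h.disjoint_of_full (a := p) (b := q) (c := x) (d := z)
      (by rw [h.symm, hp.1.2.2]) (by rw [h.symm, hq.2]) (by rw [h.symm, hp.2])
      (by rw [h.symm, hq.1.2.2])) hpq hi

end DenseRainbowFree

end Colouring

namespace UniformHypergraph

section Links

variable {V : Type*} [DecidableEq V] {H : UniformHypergraph 3 V} {U W : Finset V} {x y z : V}
  {s : Fin 4 → V} {η : ℝ}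

/-- The vertices `x`, `y`, `z` form a hyperedge. -/
def Triple (H : UniformHypergraph 3 V) (x y z : V) : Prop := {x, y, z} ∈ H.edges

instance : Decidable (H.Triple x y z) := inferInstanceAs (Decidable (_ ∈ H.edges))

/-- The link of `x` in `U`, as a set of ordered pairs. -/
def link (H : UniformHypergraph 3 V) (U : Finset V) (x : V) : Finset (V × V) :=
  {p ∈ U ×ˢ U | H.Triple x p.1 p.2}

/-- The number of hyperedges `xyz` with `z ∈ U`. -/
def codegree (H : UniformHypergraph 3 V) (U : Finset V) (x y : V) : ℕ := #{z ∈ U | H.Triple x y z}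

/-- The four vertices `s 0, …, s 3` span a complete `3`-uniform hypergraph. -/
def IsTetrahedron (H : UniformHypergraph 3 V) (s : Fin 4 → V) : Prop :=
  ∀ e ∈ powersetCard 3 univ, image s e ∈ H.edges

/-- The colours of a pair with respect to `s`: the indices `i` whose link contains the pair. -/
def linkColours (H : UniformHypergraph 3 V) (s : Fin 4 → V) (x y : V) : Finset (Fin 4) :=
  {i | H.Triple (s i) x y}

theorem triple_swap : H.Triple x y z ↔ H.Triple y x z := by rw [Triple, insert_comm, Triple]

theorem triple_swap' : H.Triple x y z ↔ H.Triple x z y := by rw [Triple, pair_comm, Triple]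

theorem Triple.rotate (h : H.Triple x y z) : H.Triple y z x := triple_swap'.1 (triple_swap.1 h)

theorem Triple.ne (h : H.Triple x y z) : x ≠ y := by
  rintro rfl
  have hcard := H.uniform _ h
  rw [insert_eq_of_mem (mem_insert_self _ _)] at hcard
  have := card_le_two (a := x) (b := z)
  omega

theorem mem_link {p : V × V} : p ∈ H.link U x ↔ (p.1 ∈ U ∧ p.2 ∈ U) ∧ H.Triple x p.1 p.2 := by
  rw [link, mem_filter, mem_product]

theorem link_subset : H.link U x ⊆ U ×ˢ U := filter_subset _ _

theorem card_link (hx : x ∈ U) : #(H.link U x) = 2 * #{e ∈ H.edges | e ⊆ U ∧ x ∈ e} := by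
  have hmaps : ∀ p ∈ H.link U x, {x, p.1, p.2} ∈ {e ∈ H.edges | e ⊆ U ∧ x ∈ e} := by
    intro p hp
    rw [mem_link] at hp
    simp only [mem_filter, insert_subset_iff, singleton_subset_iff]
    exact ⟨hp.2, ⟨hx, hp.1⟩, mem_insert_self _ _⟩
  have hfiber : ∀ e ∈ {e ∈ H.edges | e ⊆ U ∧ x ∈ e},
      #{p ∈ H.link U x | ({x, p.1, p.2} : Finset V) = e} = 2 := by
    intro e he
    obtain ⟨he, heU, hxe⟩ := mem_filter.1 he
    have hpairs : {p ∈ H.link U x | ({x, p.1, p.2} : Finset V) = e} = (e.erase x).offDiag := by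
      ext ⟨y, z⟩
      simp only [mem_filter, mem_link, mem_offDiag]
      refine ⟨?_, fun ⟨hy, hz, hyz⟩ => ?_⟩
      · rintro ⟨⟨-, hT⟩, rfl⟩
        have := hT.ne
        have := hT.rotate.ne
        have := hT.rotate.rotate.ne
        grind
      · rw [mem_erase] at hy hz
        have hxyz : ({x, y, z} : Finset V) = e := by
          refine eq_of_subset_of_card_le ?_ ?_
          · grind
          · rw [H.uniform e he, card_eq_three.2 ⟨x, y, z, hy.1.symm, hz.1.symm, hyz, rfl⟩]
        exact ⟨⟨⟨heU hy.2, heU hz.2⟩, by rwa [Triple, hxyz]⟩, hxyz⟩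
    rw [hpairs, offDiag_card, card_erase_of_mem hxe, H.uniform e he]
  rw [card_eq_sum_card_fiberwise hmaps, sum_const_nat hfiber, mul_comm]

theorem sum_card_link (H : UniformHypergraph 3 V) (U : Finset V) :
    ∑ x ∈ U, #(H.link U x) = 6 * H.edgesIn U := by
  have hincidence : ∑ x ∈ U, #{e ∈ {e ∈ H.edges | e ⊆ U} | x ∈ e} = H.edgesIn U * 3 := by
    refine (sum_card_bipartiteAbove_eq_sum_card_bipartiteBelow (· ∈ ·)).trans
      (sum_const_nat fun e he => ?_)
    obtain ⟨he, heU⟩ := mem_filter.1 he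
    rw [bipartiteBelow, filter_mem_eq_inter, inter_eq_right.2 heU, H.uniform e he]
  rw [sum_congr rfl fun x hx => card_link hx, ← mul_sum]
  simp only [filter_filter] at hincidence
  omega

theorem two_mul_edgesIn (hx : x ∈ U) :
    2 * H.edgesIn U = 2 * H.edgesIn (U.erase x) + #(H.link U x) := by
  have hsplit := card_filter_add_card_filter_not (s := {e ∈ H.edges | e ⊆ U}) (x ∈ ·)
  have herase : {e ∈ H.edges | e ⊆ U ∧ x ∉ e} = {e ∈ H.edges | e ⊆ U.erase x} :=
    filter_congr fun e _ => subset_erase.symm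
  rw [filter_filter, filter_filter, herase, ← edgesIn, ← edgesIn] at hsplit
  rw [card_link hx]
  omega

theorem edgesIn_univ [Fintype V] (H : UniformHypergraph 3 V) : H.edgesIn univ = #H.edges := by
  rw [edgesIn, filter_true_of_mem fun e _ => subset_univ e]

theorem IsTetrahedron.triple (hs : H.IsTetrahedron s) {i j k : Fin 4} (hij : i ≠ j) (hik : i ≠ k)
    (hjk : j ≠ k) : H.Triple (s i) (s j) (s k) := by
  have := hs {i, j, k} (mem_powersetCard_univ.2 (card_eq_three.2 ⟨i, j, k, hij, hik, hjk, rfl⟩))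
  rwa [image_insert, image_insert, image_singleton] at this

theorem isTetrahedron_of_triples {t : V} (hxyz : H.Triple x y z) (hxyt : H.Triple x y t)
    (hxzt : H.Triple x z t) (hyzt : H.Triple y z t) : H.IsTetrahedron ![x, y, z, t] := by
  intro e he
  rw [show powersetCard 3 (univ : Finset (Fin 4)) = {{0, 1, 2}, {0, 1, 3}, {0, 2, 3}, {1, 2, 3}} by
    decide] at he
  simp only [mem_insert, mem_singleton] at he
  rcases he with rfl | rfl | rfl | rfl <;> simp only [image_insert, image_singleton]
  exacts [hxyz, hxyt, hxzt, hyzt]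

theorem codegree_add_le (hU : ∀ s, (∀ i, s i ∈ U) → ¬ H.IsTetrahedron s) (hx : x ∈ U) (hy : y ∈ U)
    (hz : z ∈ U) (hxyz : H.Triple x y z) :
    H.codegree U x y + (H.codegree U x z + H.codegree U y z) ≤ #U * 2 := by
  simp only [codegree, card_filter, ← sum_add_distrib]
  refine sum_le_card_nsmul _ _ _ fun t ht => ?_
  have hno : ¬ (H.Triple x y t ∧ H.Triple x z t ∧ H.Triple y z t) := fun ⟨hxyt, hxzt, hyzt⟩ => by
    refine hU _ (fun i => ?_) (isTetrahedron_of_triples hxyz hxyt hxzt hyzt)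
    fin_cases i <;> assumption
  split_ifs <;> first | omega | tauto

theorem exists_isTetrahedron (hU : #U ^ 3 < 9 * H.edgesIn U) :
    ∃ s, (∀ i, s i ∈ U) ∧ H.IsTetrahedron s := by
  by_contra! hno
  set d := H.codegree U with hd
  have hlink (x : V) : ∑ y ∈ U, d x y = #(H.link U x) := by
    simp only [link, card_filter, sum_product, hd, codegree]
  have hxy : ∑ x ∈ U, ∑ y ∈ U, ∑ z ∈ U with H.Triple x y z, d x y = ∑ x ∈ U, ∑ y ∈ U, d x y ^ 2 :=
    sum_congr rfl fun x _ => sum_congr rfl fun y _ => by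
      rw [sum_const, smul_eq_mul, sq, hd, ← codegree]
  have hxz : ∑ x ∈ U, ∑ y ∈ U, ∑ z ∈ U with H.Triple x y z, d x z =
      ∑ x ∈ U, ∑ y ∈ U, d x y ^ 2 := by
    rw [← hxy]
    refine sum_congr rfl fun x _ => sum_comm' fun y z => ?_
    rw [mem_filter, mem_filter, triple_swap']
    tauto
  have hyz : ∑ x ∈ U, ∑ y ∈ U, ∑ z ∈ U with H.Triple x y z, d y z =
      ∑ x ∈ U, ∑ y ∈ U, d x y ^ 2 := by
    rw [sum_comm, ← hxz]
    simp only [triple_swap]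
  have hle : 3 * ∑ x ∈ U, ∑ y ∈ U, d x y ^ 2 ≤ 2 * #U * (6 * H.edgesIn U) := by
    calc 3 * ∑ x ∈ U, ∑ y ∈ U, d x y ^ 2
        = ∑ x ∈ U, ∑ y ∈ U, ∑ z ∈ U with H.Triple x y z, (d x y + (d x z + d y z)) := by
          simp only [sum_add_distrib, hxy, hxz, hyz]
          ring
      _ ≤ ∑ x ∈ U, ∑ y ∈ U, ∑ z ∈ U with H.Triple x y z, #U * 2 :=
          sum_le_sum fun x hx => sum_le_sum fun y hy => sum_le_sum fun z hz =>
            codegree_add_le hno hx hy (mem_filter.1 hz).1 (mem_filter.1 hz).2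
      _ = 2 * #U * (6 * H.edgesIn U) := by
          simp only [← sum_card_link, ← hlink, hd, codegree, sum_const, smul_eq_mul, ← sum_mul]
          ring
  have hcs : (6 * H.edgesIn U) ^ 2 ≤ #U ^ 2 * ∑ x ∈ U, ∑ y ∈ U, d x y ^ 2 := by
    have := sq_sum_le_card_mul_sum_sq (s := U ×ˢ U) (f := fun p => d p.1 p.2)
    rwa [sum_product, sum_product, card_product, ← sq, sum_congr rfl fun x _ => hlink x,
      sum_card_link] at this
  have hpos : 0 < H.edgesIn U := by omega
  nlinarith [Nat.mul_le_mul_left (#U ^ 2) hle, Nat.mul_lt_mul_of_pos_right hU hpos]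

theorem Free.no_fano_triples (hH : H.Free fano) {a b c d : V} (hxyz : H.Triple x y z)
    (hxab : H.Triple x a b) (hxcd : H.Triple x c d) (hyac : H.Triple y a c)
    (hybd : H.Triple y b d) (hzad : H.Triple z a d) (hzbc : H.Triple z b c) : False := by
  have hne : [x, y, a, z, c, d, b].Nodup := by
    have hnodup {u v w : V} (h : H.Triple u v w) : u ≠ v ∧ v ≠ w ∧ w ≠ u :=
      ⟨h.ne, h.rotate.ne, h.rotate.rotate.ne⟩
    have := hnodup hxyz
    have := hnodup hxab
    have := hnodup hxcd
    have := hnodup hyac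
    have := hnodup hybd
    have := hnodup hzad
    have := hnodup hzbc
    simp only [List.nodup_cons, List.mem_cons, List.not_mem_nil, List.nodup_nil]
    tauto
  refine hH ⟨⟨[x, y, a, z, c, d, b].get, List.nodup_iff_injective_get.1 hne⟩, fun e he => ?_⟩
  simp only [fano, mem_insert, mem_singleton] at he
  rcases he with rfl | rfl | rfl | rfl | rfl | rfl | rfl <;>
    simp only [map_insert, map_singleton]
  exacts [hxyz, hyac, triple_swap.1 hzad, triple_swap'.1 hzbc, hxcd.rotate,
    triple_swap.1 hybd.rotate, hxab.rotate.rotate]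

theorem mem_linkColours {i : Fin 4} : i ∈ H.linkColours s x y ↔ H.Triple (s i) x y := by
  rw [linkColours, mem_filter_univ]

theorem Free.rainbowFree (hH : H.Free fano) (hs : H.IsTetrahedron s) :
    RainbowFree (H.linkColours s) where
  symm x y := by
    ext i
    rw [mem_linkColours, mem_linkColours, triple_swap']
  irrefl x := eq_empty_of_forall_notMem fun i hi => (mem_linkColours.1 hi).rotate.ne rfl
  free a b c d i hi j hj k hk hij hik hjk := by
    simp only [mem_inter, mem_linkColours] at hi hj hk
    exact hH.no_fano_triples (hs.triple hij hik hjk) hi.1 hi.2 hj.1 hj.2 hk.1 hk.2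

theorem colourVolume_linkColours (H : UniformHypergraph 3 V) (s : Fin 4 → V) (U : Finset V) :
    colourVolume (H.linkColours s) U = ∑ i, #(H.link U (s i)) := by
  simp only [link, card_filter, sum_product]
  rw [sum_comm, colourVolume]
  refine sum_congr rfl fun x _ => ?_
  rw [sum_comm, colourDegree]
  refine sum_congr rfl fun y _ => ?_
  rw [linkColours, card_filter]

theorem Free.exists_card_link_le (hH : H.Free fano) (hW : W.Nonempty) :
    ∃ x ∈ W, 4 * #(H.link W x) ≤ 3 * (#W ^ 2 + #W) := by
  by_contra! hd
  have hsum : #W * (3 * (#W ^ 2 + #W)) ≤ 4 * (6 * H.edgesIn W) := by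
    rw [← sum_card_link, mul_sum]
    exact card_nsmul_le_sum _ _ _ fun x hx => (hd x hx).le
  obtain ⟨s, hsW, hs⟩ := exists_isTetrahedron (H := H) (U := W) (by
    have := pow_pos hW.card_pos 3
    nlinarith)
  have hvolume : colourVolume (H.linkColours s) W ≤ 3 * #W ^ 2 + 3 * #W :=
    mod_cast (hH.rainbowFree hs).colourVolume_le W
  rw [colourVolume_linkColours, Fin.sum_univ_four] at hvolume
  have := hd _ (hsW 0)
  have := hd _ (hsW 1)
  have := hd _ (hsW 2)
  have := hd _ (hsW 3)
  omega

theorem Free.edgesIn_le (hH : H.Free fano) (W : Finset V) :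
    (H.edgesIn W : ℝ) ≤ 1 / 8 * #W ^ 3 + 3 / 4 * #W ^ 2 := by
  have hpeel := le_empty_of_forall_exists_erase
    (F := fun W => (H.edgesIn W : ℝ) - (1 / 8 * #W ^ 3 + 3 / 4 * #W ^ 2)) (fun W hW => by
      obtain ⟨x, hx, hlink⟩ := hH.exists_card_link_le hW
      refine ⟨x, hx, ?_⟩
      have hlink' : (4 * #(H.link W x) : ℝ) ≤ 3 * (#W ^ 2 + #W) := mod_cast hlink
      have hedges : (2 * H.edgesIn W : ℝ) = 2 * H.edgesIn (W.erase x) + #(H.link W x) :=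
        mod_cast two_mul_edgesIn hx
      have hpos : (1 : ℝ) ≤ #W := mod_cast hW.card_pos
      rw [cast_card_erase_of_mem hx]
      nlinarith) W
  have hempty : H.edgesIn ∅ = 0 := by
    have := H.sum_card_link ∅
    rw [sum_empty] at this
    omega
  simpa [hempty] using hpeel

end Links

section LargeLinks

variable {V : Type*} {U S A B X : Finset V} {p x y z : V} {s : Fin 4 → V} {η : ℝ}

/-- `S` contains nearly half of the vertices of `U`, or more. -/
structure IsHalf (U S : Finset V) (η : ℝ) : Prop where
  subset : S ⊆ U
  le_card : (1 / 2 - 20 * η) * #U ≤ #S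

theorem IsHalf.le_sq_card (hS : IsHalf U S η) (hη : η ≤ 1 / 40) :
    (1 / 4 - 20 * η + 400 * η ^ 2) * #U ^ 2 ≤ (#S : ℝ) ^ 2 := by
  have hpos : 0 ≤ (1 / 2 - 20 * η) * #U := mul_nonneg (by linarith) (Nat.cast_nonneg _)
  linarith [pow_le_pow_left₀ hpos hS.le_card 2]

variable [DecidableEq V] {H : UniformHypergraph 3 V}

/-- `U` is large and the link in `U` of each of its vertices has nearly the largest size
`3 / 4 * #U ^ 2` that all these links can have in a Fano-free hypergraph. -/
structure LargeLinks (H : UniformHypergraph 3 V) (U : Finset V) (η : ℝ) : Prop where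
  pos : 0 < η
  small : η ≤ 1 / 10000
  le_card : 6 / η ^ 2 ≤ #U
  le_card_link : ∀ x ∈ U, (3 / 4 - η ^ 2 / 4) * #U ^ 2 ≤ #(H.link U x)

/-- The pairs of `U` that are neither contained in `S` nor in the link of `x`. There are few of
them if `S` is about half of `U` and the link of `x` is large and avoids the pairs inside `S`. -/
def missingPairs (H : UniformHypergraph 3 V) (U S : Finset V) (x : V) : Finset (V × V) :=
  (U ×ˢ U) \ (S ×ˢ S ∪ H.link U x)

theorem Free.exists_largeLinks (hH : H.Free fano) (hη : 0 < η) (hη' : η ≤ 1 / 10000)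
    (hU : 1728 / η ^ 4 ≤ #U) (hedges : (1 / 8 - η ^ 4 / 2304) * #U ^ 3 ≤ H.edgesIn U) :
    ∃ W ⊆ U, (1 - η) * #U ≤ #W ∧ H.LargeLinks W η := by
  rw [div_le_iff₀' (by positivity)] at hU
  obtain ⟨W, hWU, hcard, hmin⟩ := exists_subset_forall_le_sub_erase
    (F := fun W => (H.edgesIn W : ℝ)) (U := U) (k := 2) (D := 3 / 4) (η := η ^ 2 / 48)
    (by positivity) hH.edgesIn_le (by linarith) (by linarith)
  have hW : (1 - η) * #U ≤ #W := by
    refine le_trans ?_ hcard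
    gcongr
    nlinarith
  have hW' : 6 ≤ η ^ 2 * #W := by
    have hη₂ : η ^ 2 ≤ 1 := by nlinarith
    have hWU : (#U : ℝ) ≤ 2 * #W := by nlinarith [Nat.cast_nonneg (α := ℝ) #U]
    nlinarith [mul_le_mul_of_nonneg_right hη₂ (by positivity : 0 ≤ η ^ 2 * #W),
      mul_le_mul_of_nonneg_left hWU (by positivity : 0 ≤ η ^ 4)]
  refine ⟨W, hWU, hW, hη, hη', (div_le_iff₀' (by positivity)).2 hW', fun x hx => ?_⟩
  have hlink : (2 * H.edgesIn W : ℝ) = 2 * H.edgesIn (W.erase x) + #(H.link W x) :=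
    mod_cast two_mul_edgesIn hx
  have hW₂ : 6 * (#W : ℝ) ≤ η ^ 2 * #W * #W := by gcongr
  have hη₂ : η ^ 2 ≤ 1 := by nlinarith
  have := hmin x hx
  push_cast at this
  nlinarith [mul_nonneg (sq_nonneg η) (Nat.cast_nonneg (α := ℝ) #W)]

theorem Free.exists_halves (hH : H.Free fano) (h : H.LargeLinks U η) (hs : H.IsTetrahedron s)
    (hsU : ∀ i, s i ∈ U) : ∃ A B, IsHalf U A η ∧ IsHalf U B η ∧ Disjoint A B ∧
      ∀ i, H.link A (s i) = ∅ ∨ H.link B (s i) = ∅ := by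
  have hη := h.pos
  have hη' := h.small
  have hvolume : (3 - η ^ 2) * #U ^ 2 ≤ colourVolume (H.linkColours s) U := by
    have hlink (i : Fin 4) := h.le_card_link _ (hsU i)
    rw [colourVolume_linkColours, Fin.sum_univ_four]
    push_cast
    linarith [hlink 0, hlink 1, hlink 2, hlink 3]
  obtain ⟨W, hWU, hcard, hW⟩ :=
    (hH.rainbowFree hs).exists_dense_subset hη (by linarith) h.le_card hvolume
  obtain ⟨A, hAW, B, hBW, hAB, hA, hB, hcolour⟩ := hW.exists_parts (by linarith)
  have hhalf : (1 / 2 - 20 * η) * #U ≤ (1 / 2 - 9 * (2 * η)) * #W := by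
    refine le_trans ?_ (mul_le_mul_of_nonneg_left hcard (by linarith))
    nlinarith [mul_nonneg (sq_nonneg η) (Nat.cast_nonneg (α := ℝ) #U),
      mul_nonneg hη.le (Nat.cast_nonneg (α := ℝ) #U)]
  refine ⟨A, B, ⟨hAW.trans hWU, hhalf.trans hA⟩, ⟨hBW.trans hWU, hhalf.trans hB⟩, hAB, fun i => ?_⟩
  have hempty {S : Finset V} (hS : ∀ p ∈ S, ∀ q ∈ S, i ∉ H.linkColours s p q) :
      H.link S (s i) = ∅ := by
    refine eq_empty_of_forall_notMem fun p hp => ?_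
    rw [mem_link] at hp
    exact hS _ hp.1.1 _ hp.1.2 (mem_linkColours.2 hp.2)
  exact (hcolour i).imp hempty hempty

namespace LargeLinks

theorem card_pos (h : H.LargeLinks U η) : (0 : ℝ) < #U := by
  have := h.pos
  exact lt_of_lt_of_le (by positivity) h.le_card

theorem card_missingPairs_le (h : H.LargeLinks U η) (hS : IsHalf U S η) (hx : x ∈ U) :
    (#(H.missingPairs U S x) : ℝ) ≤ 20 * η * #U ^ 2 + #(H.link S x) := by
  have hη := h.small
  have hsub : S ×ˢ S ∪ H.link U x ⊆ U ×ˢ U :=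
    union_subset (product_subset_product hS.subset hS.subset) link_subset
  have hlink : (S ×ˢ S) ∩ H.link U x = H.link S x := by
    ext q
    have := @hS.subset q.1
    have := @hS.subset q.2
    simp only [mem_inter, mem_product, mem_link]
    tauto
  have hcard := card_union_add_card_inter (S ×ˢ S) (H.link U x)
  rw [hlink, card_product] at hcard
  have hcard' : (#(S ×ˢ S ∪ H.link U x) + #(H.link S x) : ℝ) = #S * #S + #(H.link U x) :=
    mod_cast hcard
  rw [missingPairs, cast_card_sdiff hsub, card_product]
  push_cast
  nlinarith [h.le_card_link x hx, hS.le_sq_card (by linarith)]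

theorem card_link_sdiff_link_le (h : H.LargeLinks U η) (hS : IsHalf U S η) (hx : x ∈ U)
    (hpS : H.link S p = ∅) (hxS : H.link S x = ∅) :
    (#(H.link U p \ H.link U x) : ℝ) ≤ 20 * η * #U ^ 2 := by
  have hsub : H.link U p \ H.link U x ⊆ H.missingPairs U S x := fun q hq => by
    have : q ∉ H.link S p := by simp [hpS]
    simp only [missingPairs, mem_sdiff, mem_union, mem_product, mem_link] at hq this ⊢
    tauto
  have := h.card_missingPairs_le hS hx
  rw [hxS, card_empty, Nat.cast_zero, add_zero] at this
  exact (Nat.cast_le.2 (card_le_card hsub)).trans this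

theorem link_dichotomy_of_isTetrahedron (h : H.LargeLinks U η) (hH : H.Free fano)
    (hs : H.IsTetrahedron s) (hsU : ∀ i, s i ∈ U) {i j : Fin 4} (hB : B ⊆ U)
    (hBj : H.link B (s j) = ∅) :
    (#(H.link U (s j) \ H.link U (s i)) : ℝ) ≤ 20 * η * #U ^ 2 ∨
      (#((B ×ˢ B) \ H.link U (s i)) : ℝ) ≤ 40 * η * #U ^ 2 := by
  obtain ⟨A', B', hA', hB', hAB', hparts⟩ := hH.exists_halves h hs hsU
  wlog hB'j : H.link B' (s j) = ∅ generalizing A' B'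
  · exact this B' A' hB' hA' hAB'.symm (fun i => (hparts i).symm) ((hparts j).resolve_right hB'j)
  rcases (hparts i).symm with hB'i | hA'i
  · exact Or.inl (h.card_link_sdiff_link_le hB' (hsU i) hB'j hB'i)
  · right
    have hsub : (B ×ˢ B) \ H.link U (s i) ⊆
        H.missingPairs U B' (s j) ∪ H.missingPairs U A' (s i) := fun q hq => by
      have := @hB q.1
      have := @hB q.2
      have : q.1 ∈ A' → q.1 ∉ B' := fun hq => disjoint_left.1 hAB' hq
      have hqj : q ∉ H.link B (s j) := by simp [hBj]
      simp only [missingPairs, mem_sdiff, mem_union, mem_product, mem_link] at hq hqj ⊢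
      tauto
    have hi := h.card_missingPairs_le hA' (hsU i)
    have hj := h.card_missingPairs_le hB' (hsU j)
    rw [hA'i, card_empty, Nat.cast_zero, add_zero] at hi
    rw [hB'j, card_empty, Nat.cast_zero, add_zero] at hj
    have hcard : (#((B ×ˢ B) \ H.link U (s i)) : ℝ) ≤
        #(H.missingPairs U B' (s j)) + #(H.missingPairs U A' (s i)) :=
      mod_cast (card_le_card hsub).trans (card_union_le _ _)
    linarith

theorem link_dichotomy (h : H.LargeLinks U η) (hH : H.Free fano) (hA : IsHalf U A η)
    (hB : IsHalf U B η) (hAB : Disjoint A B) (hp : p ∈ U) (hx : x ∈ U) (hpB : H.link B p = ∅)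
    (hpx : 200 * #{y ∈ A | ¬ H.Triple p x y} ≤ #U) :
    (#(H.link U p \ H.link U x) : ℝ) ≤ 20 * η * #U ^ 2 ∨
      (#((B ×ˢ B) \ H.link U x) : ℝ) ≤ (40 * η + 1 / 100) * #U ^ 2 := by
  by_cases hK : ∃ y ∈ A, ∃ z ∈ A, H.Triple p x y ∧ H.Triple p x z ∧ H.Triple p y z ∧ H.Triple x y z
  · obtain ⟨y, hy, z, hz, hxy, hxz, hyz, hxyz⟩ := hK
    have hs := isTetrahedron_of_triples hxy hxz hyz hxyz
    refine (h.link_dichotomy_of_isTetrahedron hH hs (i := 1) (j := 0) (fun i => ?_) hB.subset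
      hpB).imp_right fun hsmall => hsmall.trans ?_
    · have := hA.subset hy
      have := hA.subset hz
      fin_cases i <;> assumption
    · gcongr
      linarith
  · right
    set N := {y ∈ A | ¬ H.Triple p x y} with hN
    have hlink : H.link A x ⊆ H.missingPairs U B p ∪ (N ×ˢ U ∪ U ×ˢ N) := fun q hq => by
      have := @hA.subset q.1
      have := @hA.subset q.2
      have : q.1 ∈ A → q.1 ∉ B := fun hq => disjoint_left.1 hAB hq
      simp only [missingPairs, mem_sdiff, mem_union, mem_product, mem_link, hN, mem_filter] at hq ⊢
      have : ¬ (H.Triple p x q.1 ∧ H.Triple p x q.2 ∧ H.Triple p q.1 q.2) := fun hp =>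
        hK ⟨q.1, hq.1.1, q.2, hq.1.2, hp.1, hp.2.1, hp.2.2, hq.2⟩
      tauto
    have hsub : (B ×ˢ B) \ H.link U x ⊆ H.missingPairs U A x := fun q hq => by
      have := @hB.subset q.1
      have := @hB.subset q.2
      have : q.1 ∈ A → q.1 ∉ B := fun hq => disjoint_left.1 hAB hq
      simp only [missingPairs, mem_sdiff, mem_union, mem_product] at hq ⊢
      tauto
    have hcard : #(H.link A x) ≤ #(H.missingPairs U B p) + (#N * #U + #U * #N) := by
      rw [← card_product, ← card_product]
      exact (card_le_card hlink).trans ((card_union_le _ _).trans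
        (Nat.add_le_add_left (card_union_le _ _) _))
    have hcard' : (#(H.link A x) : ℝ) ≤ #(H.missingPairs U B p) + (#N * #U + #U * #N) :=
      mod_cast hcard
    have hNU : (200 * #N * #U : ℝ) ≤ #U * #U := mod_cast Nat.mul_le_mul_right #U hpx
    have hsub' : (#((B ×ˢ B) \ H.link U x) : ℝ) ≤ #(H.missingPairs U A x) :=
      mod_cast card_le_card hsub
    have hmissing := h.card_missingPairs_le hB hp
    rw [hpB, card_empty, Nat.cast_zero, add_zero] at hmissing
    linarith [h.card_missingPairs_le hA hx]

theorem card_exceptional_le (h : H.LargeLinks U η) (hA : A ⊆ U) (hB : IsHalf U B η)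
    (hAB : Disjoint A B) (hp : p ∈ U) (hpB : H.link B p = ∅) :
    (#{x ∈ U | ¬ 200 * #{y ∈ A | ¬ H.Triple p x y} ≤ #U} : ℝ) ≤ 4000 * η * #U := by
  set E := {x ∈ U | ¬ 200 * #{y ∈ A | ¬ H.Triple p x y} ≤ #U} with hE
  have hsub : {q ∈ E ×ˢ A | ¬ H.Triple p q.1 q.2} ⊆ H.missingPairs U B p := fun q hq => by
    have := @hA q.2
    have : q.2 ∈ A → q.2 ∉ B := fun hq => disjoint_left.1 hAB hq
    simp only [missingPairs, mem_sdiff, mem_union, mem_product, mem_link, hE, mem_filter] at hq ⊢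
    tauto
  have hcount : #E * #U ≤ 200 * #{q ∈ E ×ˢ A | ¬ H.Triple p q.1 q.2} := by
    have hfibre : #{q ∈ E ×ˢ A | ¬ H.Triple p q.1 q.2} = ∑ x ∈ E, #{y ∈ A | ¬ H.Triple p x y} := by
      simp only [card_filter, sum_product]
    rw [hfibre, mul_sum]
    exact card_nsmul_le_sum _ _ _ fun x hx => (not_le.1 (mem_filter.1 hx).2).le
  have hcount' : (#E * #U : ℝ) ≤ 200 * #(H.missingPairs U B p) :=
    mod_cast hcount.trans (Nat.mul_le_mul_left _ (card_le_card hsub))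
  have hmissing := h.card_missingPairs_le hB hp
  rw [hpB, card_empty, Nat.cast_zero, add_zero] at hmissing
  refine le_of_mul_le_mul_right ?_ h.card_pos
  linarith

end LargeLinks

theorem Free.edgesIn_eq_zero (hH : H.Free fano) {L : Finset (V × V)} {κ : ℝ} (hL : L ⊆ S ×ˢ S)
    (hX : ∀ x ∈ X, (#(L \ H.link U x) : ℝ) ≤ κ) (hcard : 2 * #S ^ 2 + 9 * κ < 3 * (#L : ℝ)) :
    H.edgesIn X = 0 := by
  by_contra hne
  obtain ⟨e, he⟩ := Finset.card_pos.1 (Nat.pos_of_ne_zero hne)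
  obtain ⟨he, heX⟩ := mem_filter.1 he
  obtain ⟨x, y, z, -, -, -, rfl⟩ := card_eq_three.1 (H.uniform e he)
  simp only [insert_subset_iff, singleton_subset_iff] at heX
  set R : V → V → Prop := fun u v => H.Triple x u v ∧ H.Triple y u v ∧ H.Triple z u v with hR
  have hcover : L ⊆ {q ∈ S ×ˢ S | R q.1 q.2} ∪
      (L \ H.link U x ∪ (L \ H.link U y ∪ L \ H.link U z)) := fun q hq => by
    have := hL hq
    simp only [mem_union, mem_filter, mem_sdiff, mem_link, hR]
    tauto
  have hcover' : #L ≤ #{q ∈ S ×ˢ S | R q.1 q.2} +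
      (#(L \ H.link U x) + (#(L \ H.link U y) + #(L \ H.link U z))) :=
    (card_le_card hcover).trans <| (card_union_le _ _).trans <| Nat.add_le_add_left
      ((card_union_le _ _).trans <| Nat.add_le_add_left (card_union_le _ _) _) _
  have hmany : (3 - 1) * #S ^ 2 < 3 * #{q ∈ S ×ˢ S | R q.1 q.2} := by
    have : (#L : ℝ) ≤ #{q ∈ S ×ˢ S | R q.1 q.2} +
      (#(L \ H.link U x) + (#(L \ H.link U y) + #(L \ H.link U z))) := mod_cast hcover'
    have : (2 * #S ^ 2 : ℝ) < 3 * #{q ∈ S ×ˢ S | R q.1 q.2} := by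
      linarith [hX x heX.1, hX y heX.2.1, hX z heX.2.2]
    exact_mod_cast this
  obtain ⟨f, -, hf⟩ := exists_clique_of_lt_card (R := R)
    (fun u v h => by simpa only [hR, triple_swap' (y := u)] using h)
    (fun u h => h.1.rotate.ne rfl) hmany
  exact hH.no_fano_triples he (hf 0 1 (by decide)).1 (hf 2 3 (by decide)).1
    (hf 0 2 (by decide)).2.1 (hf 1 3 (by decide)).2.1 (hf 0 3 (by decide)).2.2
    (hf 1 2 (by decide)).2.2

theorem LargeLinks.exists_isTetrahedron (h : H.LargeLinks U η) :
    ∃ s, (∀ i, s i ∈ U) ∧ H.IsTetrahedron s := by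
  refine UniformHypergraph.exists_isTetrahedron ?_
  have hlinks : #U * ((3 / 4 - η ^ 2 / 4) * #U ^ 2) ≤ (6 * H.edgesIn U : ℝ) := by
    rw [← nsmul_eq_mul]
    refine (card_nsmul_le_sum U (fun x => (#(H.link U x) : ℝ)) _ h.le_card_link).trans_eq ?_
    exact_mod_cast H.sum_card_link U
  have : (#U ^ 3 : ℝ) < 9 * H.edgesIn U := by
    have hη : η ^ 2 < 1 / 10 := by nlinarith [h.pos, h.small]
    nlinarith [pow_pos h.card_pos 3, mul_lt_mul_of_pos_right hη (pow_pos h.card_pos 3)]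
  exact_mod_cast this

theorem Free.exists_independent_parts (hH : H.Free fano) (h : H.LargeLinks U η) :
    ∃ X Y, Disjoint X Y ∧ (#U : ℝ) ≤ #X + #Y + 4000 * η * #U ∧ H.edgesIn X = 0 ∧
      H.edgesIn Y = 0 := by
  classical
  have hη := h.pos
  have hη' := h.small
  have hU₂ : (0 : ℝ) < #U ^ 2 := pow_pos h.card_pos 2
  obtain ⟨s, hsU, hs⟩ := h.exists_isTetrahedron
  obtain ⟨A, B, hA, hB, hAB, hparts⟩ := hH.exists_halves h hs hsU
  wlog hB₀ : H.link B (s 0) = ∅ generalizing A B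
  · exact this B A hB hA hAB.symm (fun i => (hparts i).symm) ((hparts 0).resolve_right hB₀)
  have hp := hsU 0
  set p := s 0
  set G := {x ∈ U | 200 * #{y ∈ A | ¬ H.Triple p x y} ≤ #U}
  set T : V → Prop := fun x => (#(H.link U p \ H.link U x) : ℝ) ≤ 20 * η * #U ^ 2
  refine ⟨{x ∈ G | T x}, {x ∈ G | ¬ T x}, disjoint_filter_filter_not _ _ _, ?_,
    hH.edgesIn_eq_zero link_subset (fun x hx => (mem_filter.1 hx).2) ?_,
    hH.edgesIn_eq_zero (U := U) (subset_refl (B ×ˢ B)) (κ := (40 * η + 1 / 100) * #U ^ 2)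
      (fun x hx => ?_) ?_⟩
  · have hsplit : (#{x ∈ G | T x} + #{x ∈ G | ¬ T x} : ℝ) = #G :=
      mod_cast card_filter_add_card_filter_not _
    have hexceptional : (#G + #{x ∈ U | ¬ 200 * #{y ∈ A | ¬ H.Triple p x y} ≤ #U} : ℝ) = #U :=
      mod_cast card_filter_add_card_filter_not _
    linarith [h.card_exceptional_le hA.subset hB hAB hp hB₀]
  · nlinarith [h.le_card_link p hp]
  · obtain ⟨hxG, hxT⟩ := mem_filter.1 hx
    obtain ⟨hxU, hxp⟩ := mem_filter.1 hxG
    exact (h.link_dichotomy hH hA hB hAB hp hxU hB₀ hxp).resolve_left hxT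
  · rw [card_product]
    push_cast
    nlinarith [hB.le_sq_card (by linarith)]

end LargeLinks

section Turan

/-- The complete bipartite `r`-uniform hypergraph with vertex classes `A` and `Aᶜ`: its hyperedges
are all the `r`-sets that meet both classes. -/
def bipartite {V : Type*} [Fintype V] [DecidableEq V] (r : ℕ) (A : Finset V) :
    UniformHypergraph r V where
  edges := {e ∈ powersetCard r univ | ¬ e ⊆ A ∧ ¬ e ⊆ Aᶜ}
  uniform _ he := (mem_powersetCard.1 (mem_filter.1 he).1).2

variable {r : ℕ} {V W : Type*} {F : UniformHypergraph r W}

theorem bipartite_free [Fintype V] [DecidableEq V]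
    (hF : ∀ χ : W → Bool, ∃ e ∈ F.edges, ∃ c, ∀ x ∈ e, χ x = c) (A : Finset V) :
    (bipartite r A).Free F := by
  rintro ⟨f, hf⟩
  obtain ⟨e, he, c, hc⟩ := hF fun x => decide (f x ∈ A)
  obtain ⟨hA, hA'⟩ := (mem_filter.1 (hf e he)).2
  cases c
  · exact hA' fun v hv => by
      obtain ⟨x, hx, rfl⟩ := mem_map.1 hv
      exact mem_compl.2 (of_decide_eq_false (hc x hx))
  · exact hA fun v hv => by
      obtain ⟨x, hx, rfl⟩ := mem_map.1 hv
      exact of_decide_eq_true (hc x hx)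

theorem choose_le_card_bipartite_edges [Fintype V] [DecidableEq V] (r : ℕ) (A : Finset V) :
    (Fintype.card V).choose r ≤
      #(bipartite r A).edges + ((#A).choose r + (#Aᶜ).choose r) := by
  have hcover : powersetCard r (univ : Finset V) ⊆
      (bipartite r A).edges ∪ (powersetCard r A ∪ powersetCard r Aᶜ) := fun e he => by
    simp only [bipartite, mem_union, mem_filter, mem_powersetCard] at he ⊢
    tauto
  rw [← card_univ, ← card_powersetCard, ← card_powersetCard r A, ← card_powersetCard r Aᶜ]
  exact (card_le_card hcover).trans
    ((card_union_le _ _).trans (Nat.add_le_add_left (card_union_le _ _) _))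

theorem Free.card_edges_le_ex {n : ℕ} {H : UniformHypergraph r (Fin n)} (hH : H.Free F) :
    #H.edges ≤ ex n F := by
  refine le_csSup ⟨Fintype.card (Finset (Fin n)), ?_⟩ ⟨H, hH, rfl⟩
  rintro m ⟨K, -, rfl⟩
  exact card_le_univ _

set_option maxRecDepth 100000 in
theorem fano_not_two_colourable (χ : Fin 7 → Bool) :
    ∃ e ∈ fano.edges, ∃ c, ∀ x ∈ e, χ x = c := by
  revert χ
  decide +kernel

theorem le_ex_fano (n : ℕ) : (1 / 8 * n ^ 3 - n ^ 2 : ℝ) ≤ ex n fano := by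
  obtain hn | hn := lt_or_ge n 2
  · have : (n : ℝ) ≤ 8 := by exact_mod_cast (show n ≤ 8 by omega)
    nlinarith [mul_nonneg (sub_nonneg.2 this) (sq_nonneg (n : ℝ)),
      Nat.cast_nonneg (α := ℝ) (ex n fano)]
  obtain ⟨A, -, hA⟩ := exists_subset_card_eq (s := (univ : Finset (Fin n))) (n := n / 2)
    (by rw [card_univ, Fintype.card_fin]; exact Nat.div_le_self n 2)
  have hA' : #Aᶜ = n - n / 2 := by rw [card_compl, Fintype.card_fin, hA]
  have hsum : (#A + #Aᶜ : ℝ) = n := mod_cast (by omega : #A + #Aᶜ = n)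
  have hdiff : (#Aᶜ - #A : ℝ) ^ 2 ≤ 1 := by
    have hle : (#A : ℝ) ≤ #Aᶜ := mod_cast (by omega : #A ≤ #Aᶜ)
    have hle' : (#Aᶜ : ℝ) ≤ #A + 1 := mod_cast (by omega : #Aᶜ ≤ #A + 1)
    nlinarith
  have hcubes : (#A ^ 3 + #Aᶜ ^ 3 : ℝ) ≤ 1 / 4 * n ^ 3 + 3 / 4 * n := by
    rw [← hsum]
    nlinarith [mul_le_mul_of_nonneg_left hdiff (Nat.cast_nonneg (α := ℝ) n)]
  have hlower : ((n : ℝ) - 2) ^ 3 / 6 ≤ n.choose 3 := by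
    have := Nat.pow_le_choose (α := ℝ) 3 n
    rw [show n + 1 - 3 = n - 2 by omega, Nat.cast_sub hn] at this
    simpa [Nat.factorial] using this
  have hupper (m : ℕ) : (m.choose 3 : ℝ) ≤ (m : ℝ) ^ 3 / 6 := by
    simpa [Nat.factorial] using Nat.choose_le_pow_div (α := ℝ) 3 m
  have hbipartite : (n.choose 3 : ℝ) ≤ ex n fano + ((#A).choose 3 + (#Aᶜ).choose 3) := by
    have hcard := choose_le_card_bipartite_edges 3 A
    rw [Fintype.card_fin] at hcard
    exact_mod_cast hcard.trans (Nat.add_le_add_right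
      (bipartite_free fano_not_two_colourable A).card_edges_le_ex _)
  have hn' : (2 : ℝ) ≤ n := mod_cast hn
  nlinarith [hupper #A, hupper #Aᶜ]

end Turan

section Stability

variable {V : Type*} [DecidableEq V] {H : UniformHypergraph 3 V}

theorem two_mul_edgesIn_le_of_edgesIn_eq_zero {X : Finset V} (hX : H.edgesIn X = 0)
    (U : Finset V) : 2 * H.edgesIn U ≤ #(U \ X) * #U ^ 2 := by
  have hcover : {e ∈ H.edges | e ⊆ U} ⊆
      (U \ X).biUnion fun x => {e ∈ H.edges | e ⊆ U ∧ x ∈ e} := fun e he => by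
    obtain ⟨he, heU⟩ := mem_filter.1 he
    have heX : ¬ e ⊆ X := fun heX => notMem_empty e <|
      card_eq_zero.1 hX ▸ mem_filter.2 ⟨he, heX⟩
    obtain ⟨x, hx, hxX⟩ := not_subset.1 heX
    exact mem_biUnion.2 ⟨x, mem_sdiff.2 ⟨heU hx, hxX⟩, mem_filter.2 ⟨he, heU, hx⟩⟩
  calc 2 * H.edgesIn U ≤ 2 * ∑ x ∈ U \ X, #{e ∈ H.edges | e ⊆ U ∧ x ∈ e} :=
        Nat.mul_le_mul_left 2 ((card_le_card hcover).trans card_biUnion_le)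
    _ = ∑ x ∈ U \ X, #(H.link U x) := by
        rw [mul_sum]
        exact sum_congr rfl fun x hx => (card_link (mem_sdiff.1 hx).1).symm
    _ ≤ #(U \ X) * #U ^ 2 := sum_le_card_nsmul _ _ _ fun x _ => by
        rw [sq, ← card_product]
        exact card_le_card link_subset

theorem Free.exists_bipartition [Fintype V] (hH : H.Free fano) {η : ℝ} (hη : 0 < η)
    (hη' : η ≤ 1 / 10000) (hn : 4608 / η ^ 4 ≤ Fintype.card V)
    (hedges : ex (Fintype.card V) fano - η ^ 4 / 4608 * Fintype.card V ^ 3 ≤ (#H.edges : ℝ)) :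
    ∃ Y : Finset V, (H.edgesIn Yᶜ + H.edgesIn Y : ℝ) ≤ 2001 * η * Fintype.card V ^ 3 := by
  set n := Fintype.card V with hn_def
  have hdense : (1 / 8 - η ^ 4 / 2304) * n ^ 3 ≤ H.edgesIn univ := by
    rw [edgesIn_univ]
    rw [div_le_iff₀' (by positivity)] at hn
    linarith [le_ex_fano n, mul_le_mul_of_nonneg_right hn (sq_nonneg (n : ℝ))]
  obtain ⟨W, -, hW, hlinks⟩ := hH.exists_largeLinks hη hη'
    (hn.trans' (by gcongr; norm_num)) hdense
  obtain ⟨X, Y, hXY, hcard, hX, hY⟩ := hH.exists_independent_parts hlinks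
  have hWn : (#W : ℝ) ≤ n := mod_cast card_le_univ W
  have hrest : (#(Yᶜ \ X) : ℝ) ≤ 4001 * η * n := by
    have hXY' : X ⊆ Yᶜ := fun x hx => mem_compl.2 (disjoint_left.1 hXY hx)
    rw [cast_card_sdiff hXY', card_compl, Nat.cast_sub (card_le_univ Y)]
    rw [card_univ, ← hn_def] at hW
    linarith [mul_le_mul_of_nonneg_left hWn hη.le]
  refine ⟨Y, ?_⟩
  have hYn : (#Yᶜ : ℝ) ≤ n := mod_cast card_le_univ Yᶜ
  have hYc : (2 * H.edgesIn Yᶜ : ℝ) ≤ 4001 * η * n * n ^ 2 := calc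
    (2 * H.edgesIn Yᶜ : ℝ) ≤ #(Yᶜ \ X) * #Yᶜ ^ 2 :=
      mod_cast two_mul_edgesIn_le_of_edgesIn_eq_zero hX Yᶜ
    _ ≤ 4001 * η * n * n ^ 2 := by gcongr
  rw [hY, Nat.cast_zero, add_zero]
  linarith [mul_nonneg hη.le (pow_nonneg (Nat.cast_nonneg (α := ℝ) n) 3)]

theorem Free.exists_bipartition_of_pow_sixtyFour [Fintype V] (hH : H.Free fano) {θ : ℝ}
    (hθ : 0 < θ) (hn : 4608 / (θ / 2000) ^ 4 + 3 ≤ Fintype.card V)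
    (hedges : ex (Fintype.card V) fano - θ ^ 64 * Fintype.card V ^ 3 / 8 ≤ (#H.edges : ℝ)) :
    ∃ Y : Finset V, (H.edgesIn Yᶜ + H.edgesIn Y : ℝ) ≤ 1.9 * θ * Fintype.card V ^ 3 := by
  set n := Fintype.card V with hn_def
  have hn₃ : (3 : ℝ) ≤ n := hn.trans' (le_add_of_nonneg_left (by positivity))
  obtain hsmall | hlarge := le_or_gt θ (1 / 5)
  · have hθ₆₀ : θ ^ 60 ≤ (1 / 5) ^ 60 := by gcongr
    have hθ₆₄ : θ ^ 64 / 8 ≤ (θ / 2000) ^ 4 / 4608 := by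
      linarith [mul_le_mul_of_nonneg_left hθ₆₀ (pow_nonneg hθ.le 4), pow_pos hθ 4]
    obtain ⟨Y, hY⟩ := hH.exists_bipartition (η := θ / 2000) (by positivity) (by linarith)
      (by linarith) (by
        refine hedges.trans' (sub_le_sub_left ?_ _)
        rw [mul_div_right_comm]
        gcongr)
    refine ⟨Y, hY.trans ?_⟩
    nlinarith [mul_nonneg hθ.le (pow_nonneg (Nat.cast_nonneg (α := ℝ) n) 3)]
  · refine ⟨∅, ?_⟩
    have hempty : (H.edgesIn ∅ : ℝ) ≤ 0 := (hH.edgesIn_le ∅).trans_eq (by simp)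
    have huniv := hH.edgesIn_le univ
    rw [card_univ, ← hn_def] at huniv
    have hn₂ : 3 * (n : ℝ) ^ 2 ≤ n * n ^ 2 := by gcongr
    have hθn : 1 / 5 * (n : ℝ) ^ 3 ≤ θ * n ^ 3 := by gcongr
    rw [compl_empty]
    linarith [pow_nonneg (Nat.cast_nonneg (α := ℝ) n) 3]

end Stability

end UniformHypergraph

theorem stability_constant_bounds :
    1.9 ≤ 9 / 16 * (3 ^ 2 * 2 ^ 4 * 139 : ℝ) ^ (1 / 8 : ℝ) ∧
      9 / 16 * (3 ^ 2 * 2 ^ 4 * 139 : ℝ) ^ (1 / 8 : ℝ) < 1.94 := by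
  set c : ℝ := (3 ^ 2 * 2 ^ 4 * 139 : ℝ) ^ (1 / 8 : ℝ) with hc
  have hc₈ : c ^ 8 = 20016 := by
    rw [hc, ← Real.rpow_natCast, ← Real.rpow_mul (by norm_num)]
    norm_num
  have hlower : 1.9 * 16 / 9 ≤ c :=
    le_of_pow_le_pow_left₀ (n := 8) (by norm_num) (by positivity) (by rw [hc₈]; norm_num)
  have hupper : c < 1.94 * 16 / 9 :=
    lt_of_pow_lt_pow_left₀ 8 (by norm_num) (by rw [hc₈]; norm_num)
  constructor <;> linarith

theorem theorem1p2_general (δ : ℝ) (hδ : 0 < δ) :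
    ∃ n₀ : ℕ, ∀ n : ℕ, n₀ ≤ n →
      ∀ (V : Type*) [Fintype V] [DecidableEq V] (H : UniformHypergraph 3 V),
        Fintype.card V = n →
        H.Free UniformHypergraph.fano →
        (UniformHypergraph.ex n UniformHypergraph.fano : ℝ) - δ * (n : ℝ) ^ 3 / 8
          ≤ (H.edges.card : ℝ) →
        ∃ A B : Finset V, A ∪ B = Finset.univ ∧ Disjoint A B ∧
          (H.edgesIn A : ℝ) + (H.edgesIn B : ℝ)
            ≤ 9 / 16 * (3 ^ 2 * 2 ^ 4 * 139 : ℝ) ^ (1 / 8 : ℝ) * δ ^ (1 / 64 : ℝ) * (n : ℝ) ^ 3 ∧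
          9 / 16 * (3 ^ 2 * 2 ^ 4 * 139 : ℝ) ^ (1 / 8 : ℝ) * δ ^ (1 / 64 : ℝ) * (n : ℝ) ^ 3
            < 1.94 * δ ^ (1 / 64 : ℝ) * (n : ℝ) ^ 3 := by
  obtain ⟨hlower, hupper⟩ := stability_constant_bounds
  set c : ℝ := 9 / 16 * (3 ^ 2 * 2 ^ 4 * 139 : ℝ) ^ (1 / 8 : ℝ)
  obtain ⟨θ, hθ, rfl⟩ : ∃ θ : ℝ, 0 < θ ∧ θ ^ 64 = δ :=
    ⟨δ ^ (1 / 64 : ℝ), by positivity, by rw [← Real.rpow_natCast, ← Real.rpow_mul hδ.le]; norm_num⟩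
  have hroot : (θ ^ 64) ^ (1 / 64 : ℝ) = θ := by
    rw [← Real.rpow_natCast, ← Real.rpow_mul hθ.le]
    norm_num
  rw [hroot]
  refine ⟨⌈4608 / (θ / 2000) ^ 4 + 3⌉₊, fun n hn V _ _ H hV hH hedges => ?_⟩
  subst hV
  obtain ⟨Y, hY⟩ := hH.exists_bipartition_of_pow_sixtyFour hθ (Nat.ceil_le.1 hn) hedges
  have hn₀ : (0 : ℝ) < Fintype.card V := (Nat.ceil_le.1 hn).trans_lt' (by positivity)
  refine ⟨Yᶜ, Y, by rw [union_comm, union_compl], disjoint_compl_left, hY.trans ?_, ?_⟩ <;> gcongr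

theorem theorem1p2 (δ : ℝ) (hδ : 0 < δ) (hδ' : δ < (1 / 36 : ℝ) ^ 8) :
    ∃ n₀ : ℕ, ∀ n : ℕ, n₀ ≤ n →
      ∀ (V : Type*) [Fintype V] [DecidableEq V] (H : UniformHypergraph 3 V),
        Fintype.card V = n →
        H.Free UniformHypergraph.fano →
        (UniformHypergraph.ex n UniformHypergraph.fano : ℝ) - δ * (n : ℝ) ^ 3 / 8
          ≤ (H.edges.card : ℝ) →
        ∃ A B : Finset V, A ∪ B = Finset.univ ∧ Disjoint A B ∧
          (H.edgesIn A : ℝ) + (H.edgesIn B : ℝ)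
            ≤ 9 / 16 * (3 ^ 2 * 2 ^ 4 * 139 : ℝ) ^ (1 / 8 : ℝ) * δ ^ (1 / 64 : ℝ) * (n : ℝ) ^ 3 ∧
          9 / 16 * (3 ^ 2 * 2 ^ 4 * 139 : ℝ) ^ (1 / 8 : ℝ) * δ ^ (1 / 64 : ℝ) * (n : ℝ) ^ 3
            < 1.94 * δ ^ (1 / 64 : ℝ) * (n : ℝ) ^ 3 :=
  theorem1p2_general δ hδ
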